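/- Let $\mathcal{C}$ be a dagger compact category: a symmetric monoidal category with unit $I$ and an identity-on-objects contravariant involution $\dagger$ with $(f\otimes g)^\dagger=f^\dagger\otimes g^\dagger$ and unitary coherence isomorphisms, in which every object $A$ has a dagger dual $A^*$, i.e. a dual with cup $\eta_A\colon I\to A^*\otimes A$ and cap $\varepsilon_A\colon A\otimes A^*\to I$ such that $\varepsilon_A=\eta_A^\dagger\circ\sigma$, where $\sigma$ is the symmetry. Suppose that $\mathcal{C}$ has zero morphisms and dagger kernels: every morphism has a kernel $k$ with $k^\dagger\circ k=\mathrm{id}$. A dagger cokernel is a cokernel $c$ with $c\circ c^\dagger=\mathrm{id}$; put $\mathrm{coker}(f)=\ker(f^\dagger)^\dagger$ and $\mathrm{im}(f)=\ker(\mathrm{coker}(f))\colon \mathrm{Im}(f)\to B$ for $f\colon A\to B$, where $\ker$ denotes the dagger kernel (unique up to a unitary). A state is a morphism $\psi\colon I\to A$; it is a kernel state if it is a dagger kernel, and kernel-pure if $\psi=0$ or there is a unitary $\mathrm{Im}(\psi)\simeq I$. A morphism $f\colon A\to B$ is kernel-pure if the state $(\mathrm{id}_{A^*}\otimes f)\circ\eta_A\colon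 I\to A^*\otimes B$ is kernel-pure. Write $\mathrm{DKer}(A)$ for the lattice of dagger kernels with codomain $A$ up to unitary isomorphism, ordered by $k\le l$ iff $k$ factors over $l$. A lattice with least element satisfies the covering law if for every atom $a$ and every element $b$, either $a\le b$ or $a\vee b$ covers $b$. Suppose that every non-zero object of $\mathcal{C}$ has a kernel state and that all identity morphisms of $\mathcal{C}$ are kernel-pure. Then the following are equivalent: 1. for every kernel state $\psi\colon I\to A$ and every dagger cokernel $c\colon A\to Q$, the state $c\circ\psi$ is kernel-pure; 2. for every kernel-pure state $\psi\colon I\to A$ and every dagger cokernel $c\colon A\to Q$, the state $c\circ\psi$ is kernel-pure; 3. kernel-pure morphisms are closed under composition; 4. for every object $A$, the lattice $\mathrm{DKer}(A)$ satisfies the covering law. -/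

import Mathlib

open CategoryTheory MonoidalCategory Limits

universe v u

/-- A dagger category: an identity-on-objects contravariant involution `dag`. -/
class DaggerCategory (C : Type u) [Category.{v} C] where
  dag {A B : C} : (A ⟶ B) → (B ⟶ A)
  dag_dag {A B : C} (f : A ⟶ B) : dag (dag f) = f
  dag_comp {A B D : C} (f : A ⟶ B) (g : B ⟶ D) : dag (f ≫ g) = dag g ≫ dag f
  dag_id (A : C) : dag (𝟙 A) = 𝟙 A

namespace DaggerCategory

section Dagger

variable {C : Type u} [Category.{v} C] [DaggerCategory C]

/-- An isometry: `dag f ∘ f = id`. -/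
def IsIsometry {A B : C} (f : A ⟶ B) : Prop := f ≫ dag f = 𝟙 A

/-- A unitary: an isomorphism whose inverse is its dagger. -/
def IsUnitary {A B : C} (f : A ⟶ B) : Prop := f ≫ dag f = 𝟙 A ∧ dag f ≫ f = 𝟙 B

theorem dag_injective {A B : C} {f g : A ⟶ B} (h : dag f = dag g) : f = g := by
  rw [← dag_dag f, h, dag_dag]

theorem IsIsometry.cancel {K A X : C} {k : K ⟶ A} (h : IsIsometry k) {f g : X ⟶ K}
    (hfg : f ≫ k = g ≫ k) : f = g := by
  have h' : k ≫ dag k = 𝟙 K := h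
  calc f = (f ≫ k) ≫ dag k := by rw [Category.assoc, h', Category.comp_id]
    _ = (g ≫ k) ≫ dag k := by rw [hfg]
    _ = g := by rw [Category.assoc, h', Category.comp_id]

theorem IsIsometry.comp {A B D : C} {f : A ⟶ B} {g : B ⟶ D} (hf : IsIsometry f)
    (hg : IsIsometry g) : IsIsometry (f ≫ g) := by
  have hf' : f ≫ dag f = 𝟙 _ := hf
  have hg' : g ≫ dag g = 𝟙 _ := hg
  change (f ≫ g) ≫ dag (f ≫ g) = 𝟙 _
  rw [dag_comp, Category.assoc, ← Category.assoc g, hg', Category.id_comp, hf']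

end Dagger

/-- A dagger symmetric monoidal category: the dagger preserves tensor products of morphisms
and all coherence isomorphisms are unitary. -/
class DaggerSymmetricMonoidal (C : Type u) [Category.{v} C] [MonoidalCategory C]
    [SymmetricCategory C] [DaggerCategory C] : Prop where
  dag_tensorHom {A B A' B' : C} (f : A ⟶ B) (g : A' ⟶ B') :
    dag (f ⊗ₘ g) = dag f ⊗ₘ dag g
  unitary_associator (A B D : C) : IsUnitary (α_ A B D).hom
  unitary_leftUnitor (A : C) : IsUnitary (λ_ A).hom
  unitary_rightUnitor (A : C) : IsUnitary (ρ_ A).hom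
  unitary_braiding (A B : C) : IsUnitary (β_ A B).hom

/-- A dagger compact category: a dagger symmetric monoidal category in which every object `A` has
a dual `A* = HasLeftDual.leftDual A`, with cup `η : I ⟶ A* ⊗ A` and cap `ε : A ⊗ A* ⟶ I`
satisfying the snake equations, which is a dagger dual: `ε = dag η ∘ σ`, where
`σ : A ⊗ A* ⟶ A* ⊗ A` is the symmetry. -/
class DaggerCompactCategory (C : Type u) [Category.{v} C] [MonoidalCategory C]
    [SymmetricCategory C] [DaggerCategory C] [LeftRigidCategory C] : Prop
    extends DaggerSymmetricMonoidal C where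
  dagger_dual (A : C) :
    (ExactPairing.evaluation (HasLeftDual.leftDual A) A) =
      (β_ A (HasLeftDual.leftDual A)).hom ≫
        dag (ExactPairing.coevaluation (HasLeftDual.leftDual A) A)

section Kernels

variable {C : Type u} [Category.{v} C] [DaggerCategory C] [HasZeroMorphisms C]

/-- `k` is a dagger kernel of `f`: a kernel of `f` which is an isometry. -/
def IsDaggerKernelOf {K A B : C} (k : K ⟶ A) (f : A ⟶ B) : Prop :=
  IsIsometry k ∧ ∃ w : k ≫ f = 0, Nonempty (IsLimit (KernelFork.ofι k w))

/-- `c` is a dagger cokernel of `f`: a cokernel of `f` whose dagger is an isometry. -/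
def IsDaggerCokernelOf {A B Q : C} (c : B ⟶ Q) (f : A ⟶ B) : Prop :=
  IsIsometry (dag c) ∧ ∃ w : f ≫ c = 0, Nonempty (IsColimit (CokernelCofork.ofπ c w))

/-- `k` is a dagger kernel (of some morphism). -/
def IsDaggerKernel {K A : C} (k : K ⟶ A) : Prop :=
  ∃ (B : C) (f : A ⟶ B), IsDaggerKernelOf k f

/-- `c` is a dagger cokernel (of some morphism). -/
def IsDaggerCokernel {B Q : C} (c : B ⟶ Q) : Prop :=
  ∃ (A : C) (f : A ⟶ B), IsDaggerCokernelOf c f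

end Kernels

/-- A dagger category has dagger kernels when every morphism has a dagger kernel. -/
class HasDaggerKernels (C : Type u) [Category.{v} C] [DaggerCategory C]
    [HasZeroMorphisms C] : Prop where
  exists_daggerKernel {A B : C} (f : A ⟶ B) : ∃ (K : C) (k : K ⟶ A), IsDaggerKernelOf k f

noncomputable section Images

variable {C : Type u} [Category.{v} C] [DaggerCategory C] [HasZeroMorphisms C]
  [HasDaggerKernels C]

/-- The domain of a chosen dagger kernel of `f`. -/
def kerObj {A B : C} (f : A ⟶ B) : C := (HasDaggerKernels.exists_daggerKernel f).choose

/-- A chosen dagger kernel of `f`; it is unique up to a unitary. -/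
def ker {A B : C} (f : A ⟶ B) : kerObj f ⟶ A :=
  (HasDaggerKernels.exists_daggerKernel f).choose_spec.choose

theorem ker_spec {A B : C} (f : A ⟶ B) : IsDaggerKernelOf (ker f) f :=
  (HasDaggerKernels.exists_daggerKernel f).choose_spec.choose_spec

/-- The dagger cokernel `coker f = dag (ker (dag f))`. -/
def coker {A B : C} (f : A ⟶ B) : B ⟶ kerObj (dag f) := dag (ker (dag f))

/-- The object `Im f`. -/
def imObj {A B : C} (f : A ⟶ B) : C := kerObj (coker f)

/-- The image `im f = ker (coker f)`. -/
def im {A B : C} (f : A ⟶ B) : imObj f ⟶ B := ker (coker f)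

end Images

section Lattice

variable {C : Type u} [Category.{v} C] [DaggerCategory C] [HasZeroMorphisms C]

theorem IsDaggerKernelOf.comp_eq_zero {K A B : C} {k : K ⟶ A} {f : A ⟶ B}
    (h : IsDaggerKernelOf k f) : k ≫ f = 0 := h.2.1

theorem IsDaggerKernelOf.exists_lift {K A B : C} {k : K ⟶ A} {f : A ⟶ B}
    (h : IsDaggerKernelOf k f) {X : C} (g : X ⟶ A) (hg : g ≫ f = 0) :
    ∃ m : X ⟶ K, m ≫ k = g := by
  obtain ⟨w, ⟨hl⟩⟩ := h.2
  exact ⟨_, (KernelFork.IsLimit.lift' hl g hg).2⟩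

/-- An isometry with the existence part of the universal property is a dagger kernel. -/
theorem isDaggerKernelOf_of_lift {K A B : C} {k : K ⟶ A} {f : A ⟶ B} (hk : IsIsometry k)
    (w : k ≫ f = 0) (hl : ∀ {X : C} (g : X ⟶ A), g ≫ f = 0 → ∃ m : X ⟶ K, m ≫ k = g) :
    IsDaggerKernelOf k f := by
  refine ⟨hk, w, ⟨?_⟩⟩
  exact KernelFork.IsLimit.ofι k w (fun g hg => (hl g hg).choose)
    (fun g hg => (hl g hg).choose_spec)
    (fun g hg m hm => hk.cancel (hm.trans (hl g hg).choose_spec.symm))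

theorem dag_zero (A B : C) : dag (0 : A ⟶ B) = 0 := by
  have h : dag ((0 : A ⟶ A) ≫ (0 : A ⟶ B)) = dag (dag (0 : A ⟶ A) ≫ (0 : A ⟶ B)) := by
    rw [zero_comp, comp_zero]
  rw [zero_comp, dag_comp, dag_dag, comp_zero] at h
  exact h

/-- A dagger kernel with codomain `A`. -/
structure DaggerKernelOver (A : C) where
  obj : C
  arrow : obj ⟶ A
  isDaggerKernel : IsDaggerKernel arrow

namespace DaggerKernelOver

variable {A : C}

theorem isIsometry (k : DaggerKernelOver A) : IsIsometry k.arrow := by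
  obtain ⟨_, _, h⟩ := k.isDaggerKernel
  exact h.1

/-- `k` factors over `l`. -/
def Le (k l : DaggerKernelOver A) : Prop := ∃ m : k.obj ⟶ l.obj, m ≫ l.arrow = k.arrow

/-- `k` and `l` differ by a unitary between their domains. -/
def UnitaryEquiv (k l : DaggerKernelOver A) : Prop :=
  ∃ m : k.obj ⟶ l.obj, IsUnitary m ∧ m ≫ l.arrow = k.arrow

theorem Le.refl (k : DaggerKernelOver A) : Le k k := ⟨𝟙 _, Category.id_comp _⟩

theorem Le.trans {k l m : DaggerKernelOver A} (h : Le k l) (h' : Le l m) : Le k m := by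
  obtain ⟨a, ha⟩ := h
  obtain ⟨b, hb⟩ := h'
  exact ⟨a ≫ b, by rw [Category.assoc, hb, ha]⟩

theorem unitaryEquiv_iff {k l : DaggerKernelOver A} : UnitaryEquiv k l ↔ Le k l ∧ Le l k := by
  constructor
  · rintro ⟨m, hm, h⟩
    refine ⟨⟨m, h⟩, ⟨dag m, ?_⟩⟩
    rw [← h, ← Category.assoc, hm.2, Category.id_comp]
  · rintro ⟨⟨m, hm⟩, ⟨n, hn⟩⟩
    have h1 : m ≫ n = 𝟙 _ := k.isIsometry.cancel (by
      rw [Category.assoc, hn, hm, Category.id_comp])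
    have h2 : n ≫ m = 𝟙 _ := l.isIsometry.cancel (by
      rw [Category.assoc, hm, hn, Category.id_comp])
    have hl : l.arrow ≫ dag l.arrow = 𝟙 _ := l.isIsometry
    have hk : k.arrow ≫ dag k.arrow = 𝟙 _ := k.isIsometry
    have h3 : dag m = n := by
      have e1 : k.arrow ≫ dag l.arrow = m := by
        rw [← hm, Category.assoc, hl, Category.comp_id]
      have e2 : l.arrow ≫ dag k.arrow = n := by
        rw [← hn, Category.assoc, hk, Category.comp_id]
      rw [← e1, dag_comp, dag_dag, e2]
    exact ⟨m, ⟨by rw [h3, h1], by rw [h3, h2]⟩, hm⟩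

instance setoid (A : C) : Setoid (DaggerKernelOver A) where
  r := UnitaryEquiv
  iseqv :=
    { refl := fun k => unitaryEquiv_iff.2 ⟨Le.refl k, Le.refl k⟩
      symm := fun h => unitaryEquiv_iff.2 (unitaryEquiv_iff.1 h).symm
      trans := fun h h' => unitaryEquiv_iff.2
        ⟨(unitaryEquiv_iff.1 h).1.trans (unitaryEquiv_iff.1 h').1,
          (unitaryEquiv_iff.1 h').2.trans (unitaryEquiv_iff.1 h).2⟩ }

end DaggerKernelOver

/-- `DKer A`: the unitary isomorphism classes of dagger kernels on `A`. -/
def DKer (A : C) := Quotient (DaggerKernelOver.setoid A)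

namespace DKer

open DaggerKernelOver

variable {A : C}

/-- The class of a dagger kernel. -/
def mk {K : C} (k : K ⟶ A) (hk : IsDaggerKernel k) : DKer A :=
  Quotient.mk _ ⟨K, k, hk⟩

/-- `k ≤ l` when `k` factors over `l`. -/
instance : PartialOrder (DKer A) where
  le := Quotient.lift₂ Le (by
    intro a b a' b' h h'
    have h1 := unitaryEquiv_iff.1 h
    have h2 := unitaryEquiv_iff.1 h'
    exact propext ⟨fun e => (h1.2.trans e).trans h2.1, fun e => (h1.1.trans e).trans h2.2⟩)
  le_refl := by
    intro a
    induction a using Quotient.inductionOn with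
    | h k => exact Le.refl k
  le_trans := by
    intro a b c
    induction a using Quotient.inductionOn
    induction b using Quotient.inductionOn
    induction c using Quotient.inductionOn
    exact Le.trans
  le_antisymm := by
    intro a b
    induction a using Quotient.inductionOn
    induction b using Quotient.inductionOn
    exact fun h h' => Quotient.sound (unitaryEquiv_iff.2 ⟨h, h'⟩)

theorem mk_le_mk {K L : C} {k : K ⟶ A} {l : L ⟶ A} {hk : IsDaggerKernel k}
    {hl : IsDaggerKernel l} : mk k hk ≤ mk l hl ↔ ∃ m : K ⟶ L, m ≫ l = k := Iff.rfl

theorem exists_rep (a : DKer A) :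
    ∃ (K : C) (k : K ⟶ A) (hk : IsDaggerKernel k), a = mk k hk := by
  induction a using Quotient.inductionOn with
  | h k => exact ⟨k.obj, k.arrow, k.isDaggerKernel, rfl⟩

end DKer

end Lattice

noncomputable section LatticeStructure

variable {C : Type u} [Category.{v} C] [DaggerCategory C] [HasZeroMorphisms C]
  [HasDaggerKernels C]

theorem isDaggerKernel_ker {A B : C} (f : A ⟶ B) : IsDaggerKernel (ker f) := ⟨_, f, ker_spec f⟩

theorem comp_coker {A B : C} (f : A ⟶ B) : f ≫ coker f = 0 := by
  apply dag_injective
  rw [dag_comp, dag_zero, coker, dag_dag, (ker_spec (dag f)).comp_eq_zero]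

/-- A dagger kernel is a kernel of its cokernel. -/
theorem isDaggerKernelOf_coker {A K : C} {k : K ⟶ A} (hk : IsDaggerKernel k) :
    IsDaggerKernelOf k (coker k) := by
  obtain ⟨B, f, hf⟩ := hk
  refine isDaggerKernelOf_of_lift hf.1 (comp_coker k) (fun g hg => hf.exists_lift g ?_)
  obtain ⟨m, hm⟩ := (ker_spec (dag k)).exists_lift (dag f) (by
    rw [← dag_comp, hf.comp_eq_zero, dag_zero])
  rw [← dag_dag f, ← hm, dag_comp, ← Category.assoc]
  change (g ≫ coker k) ≫ _ = 0
  rw [hg, zero_comp]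

/-- Dagger kernels are closed under composition. -/
theorem IsDaggerKernel.comp {A K M : C} {m : M ⟶ K} {k : K ⟶ A} (hm : IsDaggerKernel m)
    (hk : IsDaggerKernel k) : IsDaggerKernel (m ≫ k) := by
  have h1 := isDaggerKernelOf_coker hm
  have h2 := isDaggerKernelOf_coker hk
  refine ⟨_, coker (m ≫ k), isDaggerKernelOf_of_lift (h1.1.comp h2.1) (comp_coker _) ?_⟩
  intro X g hg
  -- a morphism that kills `m ≫ k` kills `g`
  have key : ∀ {Y : C} (t : A ⟶ Y), (m ≫ k) ≫ t = 0 → g ≫ t = 0 := by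
    intro Y t ht
    obtain ⟨s, hs⟩ := (ker_spec (dag (m ≫ k))).exists_lift (dag t) (by
      rw [← dag_comp, ht, dag_zero])
    rw [← dag_dag t, ← hs, dag_comp, ← Category.assoc]
    change (g ≫ coker (m ≫ k)) ≫ _ = 0
    rw [hg, zero_comp]
  obtain ⟨g', hg'⟩ := h2.exists_lift g (key _ (by
    rw [Category.assoc, comp_coker, comp_zero]))
  have hkk : k ≫ dag k = 𝟙 K := h2.1
  have hz := key (dag k ≫ coker m) (by
    rw [Category.assoc, ← Category.assoc k, hkk, Category.id_comp, comp_coker])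
  rw [← hg', Category.assoc, ← Category.assoc k, hkk, Category.id_comp] at hz
  obtain ⟨g'', hg''⟩ := h1.exists_lift g' hz
  exact ⟨g'', by rw [← Category.assoc, hg'', hg']⟩

namespace DaggerKernelOver

variable {A : C}

/-- The meet `k ∘ ker (coker l ∘ k)` of `k` and `l`. -/
def inf (k l : DaggerKernelOver A) : DaggerKernelOver A where
  obj := kerObj (k.arrow ≫ coker l.arrow)
  arrow := ker (k.arrow ≫ coker l.arrow) ≫ k.arrow
  isDaggerKernel := (isDaggerKernel_ker _).comp k.isDaggerKernel

/-- The orthocomplement `dag (coker k)` of `k`. -/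
def compl (k : DaggerKernelOver A) : DaggerKernelOver A where
  obj := kerObj (dag k.arrow)
  arrow := dag (coker k.arrow)
  isDaggerKernel := by
    rw [coker, dag_dag]
    exact isDaggerKernel_ker _

theorem le_inf_iff {x k l : DaggerKernelOver A} : Le x (inf k l) ↔ Le x k ∧ Le x l := by
  have hl := isDaggerKernelOf_coker l.isDaggerKernel
  have hi := ker_spec (k.arrow ≫ coker l.arrow)
  constructor
  · intro h
    obtain ⟨m, hm⟩ : ∃ m : x.obj ⟶ kerObj (k.arrow ≫ coker l.arrow),
      m ≫ ker (k.arrow ≫ coker l.arrow) ≫ k.arrow = x.arrow := h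
    refine ⟨⟨m ≫ ker _, by rw [Category.assoc, hm]⟩, hl.exists_lift _ ?_⟩
    rw [← hm, Category.assoc, Category.assoc, hi.comp_eq_zero, comp_zero]
  · rintro ⟨⟨m, hm⟩, ⟨n, hn⟩⟩
    obtain ⟨p, hp⟩ := hi.exists_lift m (by
      rw [← Category.assoc, hm, ← hn, Category.assoc, comp_coker, comp_zero])
    refine ⟨p, ?_⟩
    change p ≫ ker _ ≫ k.arrow = _
    rw [← Category.assoc, hp, hm]

theorem compl_le_compl {k l : DaggerKernelOver A} (h : Le k l) : Le (compl l) (compl k) := by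
  obtain ⟨m, hm⟩ := h
  have h1 := ker_spec (dag l.arrow)
  change ∃ n, n ≫ dag (dag (ker (dag k.arrow))) = dag (dag (ker (dag l.arrow)))
  rw [dag_dag, dag_dag]
  refine (ker_spec (dag k.arrow)).exists_lift _ ?_
  rw [← hm, dag_comp, ← Category.assoc, h1.comp_eq_zero, zero_comp]

theorem compl_compl_equiv (k : DaggerKernelOver A) : UnitaryEquiv (compl (compl k)) k := by
  have hk := isDaggerKernelOf_coker k.isDaggerKernel
  have hc := ker_spec (dag (dag (coker k.arrow)))
  rw [unitaryEquiv_iff]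
  constructor
  · change ∃ n, n ≫ k.arrow = dag (dag (ker (dag (dag (coker k.arrow)))))
    refine hk.exists_lift _ ?_
    have e := hc.comp_eq_zero
    rw [dag_dag (ker _)]
    exact (congrArg (ker (dag (dag (coker k.arrow))) ≫ ·) (dag_dag (coker k.arrow))).symm.trans e
  · change ∃ n, n ≫ dag (dag (ker (dag (dag (coker k.arrow))))) = k.arrow
    rw [dag_dag (ker _)]
    exact hc.exists_lift _ (by rw [dag_dag (coker k.arrow), comp_coker])

end DaggerKernelOver

namespace DKer

open DaggerKernelOver

variable {A : C}

/-- The orthocomplement of a class of dagger kernels. -/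
def compl : DKer A → DKer A :=
  Quotient.map DaggerKernelOver.compl (fun _ _ h =>
    unitaryEquiv_iff.2 ⟨compl_le_compl (unitaryEquiv_iff.1 h).2,
      compl_le_compl (unitaryEquiv_iff.1 h).1⟩)

theorem compl_antitone {a b : DKer A} (h : a ≤ b) : compl b ≤ compl a := by
  induction a using Quotient.inductionOn
  induction b using Quotient.inductionOn
  exact compl_le_compl h

theorem compl_compl (a : DKer A) : compl (compl a) = a := by
  induction a using Quotient.inductionOn
  exact Quotient.sound (compl_compl_equiv _)

/-- The meet of two classes of dagger kernels. -/
def inf : DKer A → DKer A → DKer A :=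
  Quotient.map₂ DaggerKernelOver.inf (by
    intro a a' h b b' h'
    have h1 := unitaryEquiv_iff.1 h
    have h2 := unitaryEquiv_iff.1 h'
    have e1 := le_inf_iff.1 (Le.refl (DaggerKernelOver.inf a b))
    have e2 := le_inf_iff.1 (Le.refl (DaggerKernelOver.inf a' b'))
    exact unitaryEquiv_iff.2 ⟨le_inf_iff.2 ⟨e1.1.trans h1.1, e1.2.trans h2.1⟩,
      le_inf_iff.2 ⟨e2.1.trans h1.2, e2.2.trans h2.2⟩⟩)

theorem le_inf_iff {x a b : DKer A} : x ≤ inf a b ↔ x ≤ a ∧ x ≤ b := by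
  induction x using Quotient.inductionOn
  induction a using Quotient.inductionOn
  induction b using Quotient.inductionOn
  exact DaggerKernelOver.le_inf_iff

/-- The lattice of dagger kernels on `A`; joins are the orthocomplements of meets of
orthocomplements. -/
instance : Lattice (DKer A) where
  inf := inf
  inf_le_left _ _ := (le_inf_iff.1 le_rfl).1
  inf_le_right _ _ := (le_inf_iff.1 le_rfl).2
  le_inf _ _ _ h h' := le_inf_iff.2 ⟨h, h'⟩
  sup a b := compl (inf (compl a) (compl b))
  le_sup_left a b := by
    have h := compl_antitone (le_inf_iff.1 (le_refl (inf (compl a) (compl b)))).1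
    rwa [compl_compl] at h
  le_sup_right a b := by
    have h := compl_antitone (le_inf_iff.1 (le_refl (inf (compl a) (compl b)))).2
    rwa [compl_compl] at h
  sup_le a b c h h' := by
    have e := compl_antitone (le_inf_iff.2 ⟨compl_antitone h, compl_antitone h'⟩)
    rwa [compl_compl] at e

/-- The bottom of `DKer A` is the class of the (zero) kernel of the identity of `A`. -/
instance : OrderBot (DKer A) where
  bot := mk (ker (𝟙 A)) (isDaggerKernel_ker _)
  bot_le a := by
    induction a using Quotient.inductionOn with
    | h k =>
      refine ⟨0, ?_⟩
      have e := (ker_spec (𝟙 A)).comp_eq_zero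
      rw [Category.comp_id] at e
      change 0 ≫ k.arrow = ker (𝟙 A)
      rw [e, zero_comp]

end DKer

end LatticeStructure

section KernelPure

variable {C : Type u} [Category.{v} C] [MonoidalCategory C] [DaggerCategory C]
  [HasZeroMorphisms C]

/-- A kernel state: a state `I ⟶ A` which is a dagger kernel. -/
def IsKernelState {A : C} (ψ : 𝟙_ C ⟶ A) : Prop := IsDaggerKernel ψ

/-- A state `ψ` is kernel-pure when `ψ = 0` or there is a unitary `Im ψ ≅ I`. -/
def IsKernelPureState [HasDaggerKernels C] {A : C} (ψ : 𝟙_ C ⟶ A) : Prop :=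
  ψ = 0 ∨ ∃ U : imObj ψ ⟶ 𝟙_ C, IsUnitary U

/-- The state `(id ⊗ f) ∘ η : I ⟶ A* ⊗ B` induced by a morphism `f : A ⟶ B`. -/
def stateOf [LeftRigidCategory C] {A B : C} (f : A ⟶ B) :
    𝟙_ C ⟶ HasLeftDual.leftDual A ⊗ B :=
  ExactPairing.coevaluation (HasLeftDual.leftDual A) A ≫ HasLeftDual.leftDual A ◁ f

/-- A morphism is kernel-pure when its induced state is. -/
def IsKernelPure [LeftRigidCategory C] [HasDaggerKernels C] {A B : C} (f : A ⟶ B) : Prop :=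
  IsKernelPureState (stateOf f)

end KernelPure

/-- The covering law: for every atom `a` and element `b`, either `a ≤ b` or `a ⊔ b` covers `b`. -/
def CoveringLaw (L : Type*) [Lattice L] [OrderBot L] : Prop :=
  ∀ a b : L, IsAtom a → a ≤ b ∨ b ⋖ a ⊔ b

end DaggerCategory

/-! Three dictionaries give the equivalence.

Order: for a dagger cokernel `c : A ⟶ Q`, inverse image along `c` identifies `DKer Q` with the
interval above `ker c` in `DKer A`, and sends the image of `ψ ≫ c` to the join of `im ψ` and `ker c`
(`pullIso`, `pull_imClass`). The atoms are the classes of kernel states (`isAtom_mk_iff`), and every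
class is the kernel of a dagger cokernel. So 1 says exactly that joining an atom to `ker c` gives
`ker c` or a cover of it, which is 4.

Scalars: kernel-pure states are the scalar multiples of kernel states, because nonzero scalars
cancel against zero (`eq_zero_of_scalar_comp`). This gives 1 → 2.

Duality: the state of `f ≫ g` is the state of `f` followed by `A* ◁ g`. Yanking the state of `g`
with a cap writes a nonzero kernel-pure `g` as a scalar times a dagger kernel followed by a dagger
cokernel (`IsKernelPure.exists_factorization`), and whiskering preserves both; this gives 2 → 3.
Conversely dagger cokernels are themselves kernel-pure, since their transposes are kernels, so
composing a state with one is a case of 3; this gives 3 → 1. -/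

namespace DaggerCategory

/-! ### Dagger kernels and cokernels under unitaries and the dagger -/

section DaggerKernels

variable {C : Type u} [Category.{v} C] [DaggerCategory C]

theorem IsUnitary.dag {A B : C} {f : A ⟶ B} (h : IsUnitary f) : IsUnitary (dag f) := by
  unfold IsUnitary
  rw [dag_dag]
  exact ⟨h.2, h.1⟩

theorem IsUnitary.comp {A B D : C} {f : A ⟶ B} {g : B ⟶ D} (hf : IsUnitary f)
    (hg : IsUnitary g) : IsUnitary (f ≫ g) := by
  refine ⟨IsIsometry.comp hf.1 hg.1, ?_⟩
  rw [dag_comp, Category.assoc, ← Category.assoc (DaggerCategory.dag f), hf.2, Category.id_comp,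
    hg.2]

theorem IsUnitary.of_inverse {A B : C} {f : A ⟶ B} {g : B ⟶ A} (h : f ≫ g = 𝟙 A)
    (h' : g ≫ f = 𝟙 B) (hd : DaggerCategory.dag f = g) : IsUnitary f := by
  subst hd
  exact ⟨h, h'⟩

theorem IsUnitary.dag_eq_inv {A B : C} {f : A ≅ B} (h : IsUnitary f.hom) :
    DaggerCategory.dag f.hom = f.inv := by
  rw [Iso.eq_inv_comp f |>.2 h.1, Category.comp_id]

theorem IsUnitary.inv {A B : C} {f : A ≅ B} (h : IsUnitary f.hom) : IsUnitary f.inv :=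
  h.dag_eq_inv ▸ h.dag

theorem IsIsometry.of_comp {A B D : C} {f : A ⟶ B} {g : B ⟶ D} (hfg : IsIsometry (f ≫ g))
    (hg : IsIsometry g) : IsIsometry f := by
  have hg' : g ≫ DaggerCategory.dag g = 𝟙 _ := hg
  have h : (f ≫ g) ≫ DaggerCategory.dag (f ≫ g) = 𝟙 _ := hfg
  rwa [dag_comp, Category.assoc, ← Category.assoc g, hg', Category.id_comp] at h

variable [HasZeroMorphisms C]

theorem IsDaggerKernel.isIsometry {A K : C} {k : K ⟶ A} (hk : IsDaggerKernel k) :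
    IsIsometry k := by
  obtain ⟨_, _, h⟩ := hk
  exact h.1

theorem IsDaggerKernelOf.comp_unitary {A A' K B : C} {k : K ⟶ A} {f : A ⟶ B}
    (hk : IsDaggerKernelOf k f) {w : A ⟶ A'} (hw : IsUnitary w) :
    IsDaggerKernelOf (k ≫ w) (dag w ≫ f) := by
  refine isDaggerKernelOf_of_lift (hk.1.comp hw.1) ?_ fun g hg => ?_
  · rw [Category.assoc, ← Category.assoc w, hw.1, Category.id_comp, hk.comp_eq_zero]
  · obtain ⟨m, hm⟩ := hk.exists_lift (g ≫ dag w) (by rw [Category.assoc, hg])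
    exact ⟨m, by rw [← Category.assoc, hm, Category.assoc, hw.2, Category.comp_id]⟩

theorem IsDaggerKernel.comp_unitary {A A' K : C} {k : K ⟶ A} (hk : IsDaggerKernel k)
    {w : A ⟶ A'} (hw : IsUnitary w) : IsDaggerKernel (k ≫ w) := by
  obtain ⟨B, f, hf⟩ := hk
  exact ⟨_, _, hf.comp_unitary hw⟩

theorem IsDaggerKernel.unitary_comp {A K K' : C} {k : K ⟶ A} (hk : IsDaggerKernel k)
    {w : K' ⟶ K} (hw : IsUnitary w) : IsDaggerKernel (w ≫ k) := by
  obtain ⟨B, f, hf⟩ := hk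
  refine ⟨B, f, isDaggerKernelOf_of_lift (IsIsometry.comp hw.1 hf.1) ?_ fun g hg => ?_⟩
  · rw [Category.assoc, hf.comp_eq_zero, comp_zero]
  · obtain ⟨m, hm⟩ := hf.exists_lift g hg
    exact ⟨m ≫ dag w, by
      rw [Category.assoc, ← Category.assoc (dag w), hw.2, Category.id_comp, hm]⟩

theorem IsDaggerCokernelOf.dag {A B Q : C} {c : B ⟶ Q} {f : A ⟶ B}
    (hc : IsDaggerCokernelOf c f) :
    IsDaggerKernelOf (DaggerCategory.dag c) (DaggerCategory.dag f) := by
  obtain ⟨hi, w, ⟨hl⟩⟩ := hc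
  refine isDaggerKernelOf_of_lift hi (by rw [← dag_comp, w, dag_zero]) fun g hg => ?_
  obtain ⟨l, e⟩ := CokernelCofork.IsColimit.desc' hl (DaggerCategory.dag g) (by
    apply dag_injective
    rw [dag_comp, dag_dag, hg, dag_zero])
  refine ⟨DaggerCategory.dag l, ?_⟩
  rw [← dag_comp]
  apply dag_injective
  rw [dag_dag]
  exact e

theorem IsDaggerKernelOf.dag {A B K : C} {k : K ⟶ A} {f : A ⟶ B}
    (hk : IsDaggerKernelOf k f) :
    IsDaggerCokernelOf (DaggerCategory.dag k) (DaggerCategory.dag f) := by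
  have hi : IsIsometry (DaggerCategory.dag (DaggerCategory.dag k)) := by
    rw [dag_dag]
    exact hk.1
  have hl : ∀ {X : C} (g : A ⟶ X), DaggerCategory.dag f ≫ g = 0 →
      ∃ m, DaggerCategory.dag k ≫ m = g := by
    intro X g hg
    obtain ⟨m, hm⟩ := hk.exists_lift (DaggerCategory.dag g) (by
      apply dag_injective
      rw [dag_comp, dag_dag, hg, dag_zero])
    exact ⟨DaggerCategory.dag m, by rw [← dag_comp, hm, dag_dag]⟩
  refine ⟨hi, by rw [← dag_comp, hk.comp_eq_zero, dag_zero], ⟨?_⟩⟩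
  refine CokernelCofork.IsColimit.ofπ _ _ (fun g hg => (hl g hg).choose)
    (fun g hg => (hl g hg).choose_spec) fun g hg m hm => ?_
  apply dag_injective
  refine hi.cancel ?_
  rw [← dag_comp, ← dag_comp, hm, (hl g hg).choose_spec]

theorem IsDaggerCokernel.dag {B Q : C} {c : B ⟶ Q} (hc : IsDaggerCokernel c) :
    IsDaggerKernel (DaggerCategory.dag c) := by
  obtain ⟨A, f, h⟩ := hc
  exact ⟨_, _, h.dag⟩

theorem IsDaggerKernel.dag {A K : C} {k : K ⟶ A} (hk : IsDaggerKernel k) :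
    IsDaggerCokernel (DaggerCategory.dag k) := by
  obtain ⟨B, f, h⟩ := hk
  exact ⟨_, _, h.dag⟩

theorem isDaggerCokernel_iff {B Q : C} {c : B ⟶ Q} :
    IsDaggerCokernel c ↔ IsDaggerKernel (dag c) :=
  ⟨fun h => h.dag, fun h => by simpa only [dag_dag] using h.dag⟩

theorem IsDaggerCokernelOf.exists_desc {A B Q : C} {c : B ⟶ Q} {f : A ⟶ B}
    (hc : IsDaggerCokernelOf c f) {X : C} (g : B ⟶ X) (hg : f ≫ g = 0) :
    ∃ m : Q ⟶ X, c ≫ m = g := by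
  obtain ⟨_, w, ⟨hl⟩⟩ := hc
  exact ⟨_, (CokernelCofork.IsColimit.desc' hl g hg).2⟩

end DaggerKernels

/-! ### Inverse and direct images of classes of dagger kernels -/

noncomputable section Subobjects

variable {C : Type u} [Category.{v} C] [DaggerCategory C] [HasZeroMorphisms C]

namespace DKer

/-- `h` factors through the class `y` of dagger kernels. -/
def Factors {A X : C} (h : X ⟶ A) (y : DKer A) : Prop :=
  Quotient.lift (fun k : DaggerKernelOver A => ∃ m : X ⟶ k.obj, m ≫ k.arrow = h) (by
    intro k l hkl
    obtain ⟨⟨p, hp⟩, ⟨q, hq⟩⟩ := DaggerKernelOver.unitaryEquiv_iff.1 hkl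
    refine propext ⟨?_, ?_⟩
    · rintro ⟨m, hm⟩
      exact ⟨m ≫ p, by rw [Category.assoc, hp, hm]⟩
    · rintro ⟨m, hm⟩
      exact ⟨m ≫ q, by rw [Category.assoc, hq, hm]⟩) y

theorem mk_le_iff {A K : C} {k : K ⟶ A} {hk : IsDaggerKernel k} {y : DKer A} :
    mk k hk ≤ y ↔ Factors k y := by
  obtain ⟨L, l, hl, rfl⟩ := exists_rep y
  exact Iff.rfl

theorem Factors.comp {A X Y : C} {h : X ⟶ A} {y : DKer A} (hy : Factors h y) (g : Y ⟶ X) :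
    Factors (g ≫ h) y := by
  obtain ⟨L, l, hl, rfl⟩ := exists_rep y
  obtain ⟨m, hm⟩ := hy
  exact ⟨g ≫ m, by
    rw [Category.assoc]
    exact congrArg (g ≫ ·) hm⟩

theorem le_iff_factors {A : C} {x y : DKer A} :
    x ≤ y ↔ ∀ {X : C} (h : X ⟶ A), Factors h x → Factors h y := by
  obtain ⟨K, k, hk, rfl⟩ := exists_rep x
  refine ⟨?_, fun H => mk_le_iff.2 (H k ⟨𝟙 _, Category.id_comp _⟩)⟩
  rintro hxy X h ⟨m, rfl⟩
  exact (mk_le_iff.1 hxy).comp m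

variable [HasDaggerKernels C]

/-- The class of the dagger kernel of `f`. -/
def kerClass {A B : C} (f : A ⟶ B) : DKer A := mk (ker f) (isDaggerKernel_ker f)

/-- The class of the image of `f`. -/
def imClass {A B : C} (f : A ⟶ B) : DKer B := kerClass (coker f)

/-- With every class presented as a kernel, comparisons in `DKer` become equations with zero. -/
theorem factors_kerClass {A B X : C} {f : A ⟶ B} {h : X ⟶ A} :
    Factors h (kerClass f) ↔ h ≫ f = 0 := by
  refine ⟨?_, fun hf => (ker_spec f).exists_lift h hf⟩
  rintro ⟨m, rfl⟩
  rw [Category.assoc]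
  exact (congrArg (m ≫ ·) (ker_spec f).comp_eq_zero).trans comp_zero

theorem exists_eq_kerClass {A : C} (y : DKer A) : ∃ (B : C) (f : A ⟶ B), y = kerClass f := by
  obtain ⟨K, k, hk, rfl⟩ := exists_rep y
  refine ⟨_, coker k, le_antisymm ?_ ?_⟩ <;> rw [le_iff_factors] <;> intro X h
  · rw [factors_kerClass]
    rintro ⟨m, rfl⟩
    rw [Category.assoc]
    exact (congrArg (m ≫ ·) (comp_coker k)).trans comp_zero
  · rw [factors_kerClass]
    exact (isDaggerKernelOf_coker hk).exists_lift h

end DKer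

theorem coker_desc {A B X : C} [HasDaggerKernels C] (f : A ⟶ B) (g : B ⟶ X) (hg : f ≫ g = 0) :
    ∃ m, coker f ≫ m = g := by
  obtain ⟨s, hs⟩ := (ker_spec (dag f)).exists_lift (dag g) (by rw [← dag_comp, hg, dag_zero])
  exact ⟨dag s, by rw [coker, ← dag_comp, hs, dag_dag]⟩

theorem isDaggerCokernel_coker [HasDaggerKernels C] {A B : C} (f : A ⟶ B) :
    IsDaggerCokernel (coker f) := by
  rw [isDaggerCokernel_iff, coker, dag_dag]
  exact isDaggerKernel_ker _

namespace DKer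

variable [HasDaggerKernels C]

/-- If `y` is the kernel of `g`, both sides amount to `f ≫ g = 0`, because such a `g` descends along
`coker f`. -/
theorem imClass_le_iff {A B : C} {f : A ⟶ B} {y : DKer B} : imClass f ≤ y ↔ Factors f y := by
  obtain ⟨D, g, rfl⟩ := exists_eq_kerClass y
  rw [factors_kerClass, le_iff_factors]
  constructor
  · intro H
    exact factors_kerClass.1 (H f (factors_kerClass.2 (comp_coker f)))
  · intro hg X h hh
    obtain ⟨m, rfl⟩ := coker_desc f g hg
    rw [factors_kerClass, ← Category.assoc, factors_kerClass.1 hh, zero_comp]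

theorem imClass_eq_mk {A K : C} {k : K ⟶ A} (hk : IsDaggerKernel k) : imClass k = mk k hk :=
  le_antisymm (imClass_le_iff.2 ⟨𝟙 _, Category.id_comp _⟩)
    (mk_le_iff.2 (imClass_le_iff.1 le_rfl))

/-- The inverse image of a class of dagger kernels along `c`. -/
def pull {A Q : C} (c : A ⟶ Q) (x : DKer Q) : DKer A :=
  kerClass (c ≫ (exists_eq_kerClass x).choose_spec.choose)

theorem factors_pull {A Q X : C} {c : A ⟶ Q} {x : DKer Q} {h : X ⟶ A} :
    Factors h (pull c x) ↔ Factors (h ≫ c) x := by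
  conv_rhs => rw [(exists_eq_kerClass x).choose_spec.choose_spec]
  rw [pull, factors_kerClass, factors_kerClass, Category.assoc]

theorem pull_kerClass {A Q B : C} (c : A ⟶ Q) (g : Q ⟶ B) :
    pull c (kerClass g) = kerClass (c ≫ g) := by
  refine le_antisymm ?_ ?_ <;> rw [le_iff_factors] <;> intro X h <;>
    rw [factors_pull, factors_kerClass, factors_kerClass, Category.assoc] <;> exact id

/-- The order is reflected because `dag c` is a section of `c`: every `h` into `Q` lifts to `h ≫ dag
c`. -/
theorem pull_le_pull_iff {A Q : C} {c : A ⟶ Q} (hc : IsIsometry (dag c)) {x y : DKer Q} :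
    pull c x ≤ pull c y ↔ x ≤ y := by
  constructor
  · intro H
    rw [le_iff_factors] at H ⊢
    intro X h hh
    have hc' : dag c ≫ dag (dag c) = 𝟙 _ := hc
    rw [dag_dag] at hc'
    have e : (h ≫ dag c) ≫ c = h := by rw [Category.assoc, hc', Category.comp_id]
    rw [← e, ← factors_pull]
    refine H _ ?_
    rwa [factors_pull, e]
  · intro H
    rw [le_iff_factors] at H ⊢
    intro X h hh
    rw [factors_pull] at hh ⊢
    exact H _ hh

theorem kerClass_le_pull {A Q : C} (c : A ⟶ Q) (x : DKer Q) : kerClass c ≤ pull c x := by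
  obtain ⟨B, g, rfl⟩ := exists_eq_kerClass x
  rw [pull_kerClass, le_iff_factors]
  intro X h
  rw [factors_kerClass, factors_kerClass]
  intro hh
  rw [← Category.assoc, hh, zero_comp]

/-- If `y` is the kernel of `g` and contains `ker c`, then `g` kills the morphism whose cokernel is
`c`, hence descends along `c`. -/
theorem exists_pull_eq {A Q : C} {c : A ⟶ Q} (hc : IsDaggerCokernel c) {y : DKer A}
    (hy : kerClass c ≤ y) : ∃ x, pull c x = y := by
  obtain ⟨B, g, rfl⟩ := exists_eq_kerClass y
  obtain ⟨M, m, hm⟩ := hc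
  obtain ⟨p, rfl⟩ := hm.exists_desc g
    (factors_kerClass.1 (le_iff_factors.1 hy m (factors_kerClass.2 hm.2.1)))
  exact ⟨kerClass p, pull_kerClass _ _⟩

/-- The inverse image along a dagger cokernel `c` identifies the dagger kernels of its codomain
with those that contain the kernel of `c`. -/
def pullIso {A Q : C} (c : A ⟶ Q) (hc : IsDaggerCokernel c) :
    DKer Q ≃o Set.Ici (kerClass c) :=
  RelIso.ofSurjective
    (OrderEmbedding.ofMapLEIff (fun x => (⟨pull c x, kerClass_le_pull c x⟩ : Set.Ici (kerClass c)))
      fun _ _ => pull_le_pull_iff hc.dag.isIsometry)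
    (fun y => by
      obtain ⟨x, hx⟩ := exists_pull_eq hc y.2
      exact ⟨x, Subtype.ext hx⟩)

/-- The direct image along a dagger cokernel `c` corresponds to the join with its kernel. -/
theorem pull_imClass {A B Q : C} {c : A ⟶ Q} (hc : IsDaggerCokernel c) (f : B ⟶ A) :
    pull c (imClass (f ≫ c)) = imClass f ⊔ kerClass c := by
  apply le_antisymm
  -- The join contains `ker c`, so it is itself an inverse image, and the comparison can be made in
  -- `DKer Q`.
  · obtain ⟨x, hx⟩ := exists_pull_eq hc (le_sup_right : kerClass c ≤ imClass f ⊔ kerClass c)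
    rw [← hx, pull_le_pull_iff hc.dag.isIsometry, imClass_le_iff, ← factors_pull,
      ← imClass_le_iff, hx]
    exact le_sup_left
  · refine sup_le ?_ (kerClass_le_pull c _)
    rw [imClass_le_iff, factors_pull, ← imClass_le_iff]

/-- Atoms of an upper interval are the covers of its least element. -/
theorem isAtom_imClass_iff {A B Q : C} {c : A ⟶ Q} (hc : IsDaggerCokernel c) (f : B ⟶ A) :
    IsAtom (imClass (f ≫ c)) ↔ kerClass c ⋖ imClass f ⊔ kerClass c := by
  rw [← (pullIso c hc).isAtom_iff, Set.Ici.isAtom_iff, ← pull_imClass hc]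
  rfl

theorem exists_eq_kerClass_cokernel {A : C} (y : DKer A) :
    ∃ (Q : C) (c : A ⟶ Q), IsDaggerCokernel c ∧ y = kerClass c := by
  obtain ⟨K, k, hk, rfl⟩ := exists_rep y
  exact ⟨_, coker k, isDaggerCokernel_coker k, (imClass_eq_mk hk).symm⟩

theorem mk_eq_bot_iff {A K : C} {k : K ⟶ A} {hk : IsDaggerKernel k} :
    mk k hk = ⊥ ↔ IsZero K := by
  rw [← le_bot_iff, mk_le_iff, IsZero.iff_id_eq_zero]
  change Factors k (kerClass (𝟙 A)) ↔ _
  rw [factors_kerClass, Category.comp_id]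
  refine ⟨fun h => hk.isIsometry.cancel ?_, fun h => ?_⟩
  · rw [h, comp_zero, comp_zero]
  · rw [← Category.id_comp k, h, zero_comp]

end DKer

end Subobjects

end DaggerCategory

namespace DaggerCategory

/-! ### Scalars and their action -/

section Monoidal

variable {C : Type u} [Category.{v} C] [MonoidalCategory C]

/-- The action of a scalar on an object. -/
def scal (s : 𝟙_ C ⟶ 𝟙_ C) (A : C) : A ⟶ A := (λ_ A).inv ≫ s ▷ A ≫ (λ_ A).hom

theorem comp_scal (s : 𝟙_ C ⟶ 𝟙_ C) {A B : C} (f : A ⟶ B) :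
    f ≫ scal s B = scal s A ≫ f := by
  simp only [scal, Category.assoc, leftUnitor_inv_naturality_assoc, ← leftUnitor_naturality,
    whisker_exchange_assoc]

theorem scal_unit (s : 𝟙_ C ⟶ 𝟙_ C) : scal s (𝟙_ C) = s := by
  simp [scal, unitors_equal, unitors_inv_equal]

theorem state_comp_scal (s : 𝟙_ C ⟶ 𝟙_ C) {A : C} (ψ : 𝟙_ C ⟶ A) :
    ψ ≫ scal s A = s ≫ ψ := by
  rw [comp_scal, scal_unit]

theorem scalar_comm (s t : 𝟙_ C ⟶ 𝟙_ C) : s ≫ t = t ≫ s := by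
  conv_lhs => rw [← scal_unit t, state_comp_scal]

theorem whiskerLeft_scal [SymmetricCategory C] (s : 𝟙_ C ⟶ 𝟙_ C) (X A : C) :
    X ◁ scal s A = scal s (X ⊗ A) := by
  have h : (ρ_ X).inv ≫ X ◁ s ≫ (ρ_ X).hom = scal s X := by
    rw [scal, ← braiding_leftUnitor, BraidedCategory.braiding_naturality_right_assoc,
      rightUnitor_inv_braiding_assoc]
  calc X ◁ scal s A = ((ρ_ X).inv ≫ X ◁ s ≫ (ρ_ X).hom) ▷ A := by
        rw [scal]; monoidal
    _ = scal s (X ⊗ A) := by rw [h, scal, scal]; monoidal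

end Monoidal

/-! ### Zero morphisms under tensoring -/

section Zero

variable {C : Type u} [Category.{v} C] [MonoidalCategory C]

theorem IsIsometry.isUnitary_scalar [DaggerCategory C] {s : 𝟙_ C ⟶ 𝟙_ C} (h : IsIsometry s) : IsUnitary s :=
  ⟨h, by rw [scalar_comm]; exact h⟩

variable [LeftRigidCategory C] [HasZeroMorphisms C]

/-- The adjunction between `A ⊗ -` and `A* ⊗ -` respects vanishing, so duals alone force tensoring
to preserve zero morphisms. -/
theorem whiskerLeft_comp_eq_zero_iff {A X Y Z : C} (f : X ⟶ Y) (g : A ⊗ Y ⟶ Z) :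
    A ◁ f ≫ g = 0 ↔ f ≫ tensorLeftHomEquiv Y (HasLeftDual.leftDual A) A Z g = 0 := by
  have h0 : (tensorLeftHomEquiv X (HasLeftDual.leftDual A) A Z).symm 0 = 0 := by
    rw [← zero_comp (X := X) (f := tensorLeftHomEquiv X (HasLeftDual.leftDual A) A Z 0),
      tensorLeftHomEquiv_symm_naturality, Equiv.symm_apply_apply, comp_zero]
  rw [← (tensorLeftHomEquiv X (HasLeftDual.leftDual A) A Z).symm.injective.eq_iff, h0,
    tensorLeftHomEquiv_symm_naturality, Equiv.symm_apply_apply]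

theorem whiskerLeft_zero' (A X Y : C) : A ◁ (0 : X ⟶ Y) = 0 := by
  rw [← Category.comp_id (A ◁ _), whiskerLeft_comp_eq_zero_iff, zero_comp]

theorem zero_whiskerRight' [SymmetricCategory C] (X Y A : C) : (0 : X ⟶ Y) ▷ A = 0 := by
  have h := BraidedCategory.braiding_naturality_left (0 : X ⟶ Y) A
  rw [whiskerLeft_zero', comp_zero] at h
  rw [← cancel_mono (β_ Y A).hom, h, zero_comp]

theorem isZero_of_isZero_unit [SymmetricCategory C] (hI : IsZero (𝟙_ C)) (A : C) : IsZero A := by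
  rw [IsZero.iff_id_eq_zero] at hI ⊢
  rw [← Iso.inv_hom_id (λ_ A), ← Category.id_comp (λ_ A).hom, ← id_whiskerRight, hI,
    zero_whiskerRight', zero_comp, comp_zero]

end Zero

/-! ### Whiskering preserves dagger kernels and cokernels -/

section DaggerMonoidal

variable {C : Type u} [Category.{v} C] [MonoidalCategory C] [SymmetricCategory C]
  [DaggerCategory C] [DaggerSymmetricMonoidal C]

theorem dag_whiskerLeft (A : C) {X Y : C} (f : X ⟶ Y) : dag (A ◁ f) = A ◁ dag f := by
  rw [← id_tensorHom, DaggerSymmetricMonoidal.dag_tensorHom, dag_id, id_tensorHom]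

theorem dag_whiskerRight {X Y : C} (f : X ⟶ Y) (A : C) : dag (f ▷ A) = dag f ▷ A := by
  rw [← tensorHom_id, DaggerSymmetricMonoidal.dag_tensorHom, dag_id, tensorHom_id]

theorem IsIsometry.whiskerLeft (A : C) {X Y : C} {f : X ⟶ Y} (h : IsIsometry f) :
    IsIsometry (A ◁ f) := by
  unfold IsIsometry at h ⊢
  rw [dag_whiskerLeft, ← MonoidalCategory.whiskerLeft_comp, h, MonoidalCategory.whiskerLeft_id]

theorem IsIsometry.whiskerRight {X Y : C} {f : X ⟶ Y} (h : IsIsometry f) (A : C) :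
    IsIsometry (f ▷ A) := by
  unfold IsIsometry at h ⊢
  rw [dag_whiskerRight, ← comp_whiskerRight, h, id_whiskerRight]

theorem IsUnitary.whiskerRight {X Y : C} {f : X ⟶ Y} (h : IsUnitary f) (A : C) :
    IsUnitary (f ▷ A) := by
  refine ⟨IsIsometry.whiskerRight h.1 A, ?_⟩
  rw [dag_whiskerRight, ← comp_whiskerRight, h.2, id_whiskerRight]

variable [LeftRigidCategory C] [HasZeroMorphisms C]

/-- As a left adjoint, `A ⊗ -` preserves cokernels; the dagger turns this into preservation of
kernels. -/
theorem IsDaggerKernelOf.whiskerLeft (A : C) {K X Y : C} {k : K ⟶ X} {f : X ⟶ Y}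
    (h : IsDaggerKernelOf k f) : IsDaggerKernelOf (A ◁ k) (A ◁ f) := by
  refine isDaggerKernelOf_of_lift (h.1.whiskerLeft A) ?_ fun g hg => ?_
  · rw [← MonoidalCategory.whiskerLeft_comp, h.comp_eq_zero, whiskerLeft_zero']
  · have h1 : A ◁ DaggerCategory.dag f ≫ DaggerCategory.dag g = 0 := by
      rw [← dag_whiskerLeft, ← dag_comp, hg, dag_zero]
    obtain ⟨m, hm⟩ := h.dag.exists_desc _ ((whiskerLeft_comp_eq_zero_iff _ _).1 h1)
    refine ⟨DaggerCategory.dag ((tensorLeftHomEquiv _ _ _ _).symm m), ?_⟩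
    apply dag_injective
    rw [dag_comp, dag_dag, dag_whiskerLeft, ← tensorLeftHomEquiv_symm_naturality, hm,
      Equiv.symm_apply_apply]

theorem IsDaggerKernelOf.whiskerRight {K X Y : C} {k : K ⟶ X} {f : X ⟶ Y}
    (h : IsDaggerKernelOf k f) (A : C) : IsDaggerKernelOf (k ▷ A) (f ▷ A) := by
  refine isDaggerKernelOf_of_lift (h.1.whiskerRight A) ?_ fun g hg => ?_
  · rw [← comp_whiskerRight, h.comp_eq_zero, zero_whiskerRight']
  · obtain ⟨m, hm⟩ := (h.whiskerLeft A).exists_lift (g ≫ (β_ _ _).hom) (by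
      rw [Category.assoc, ← BraidedCategory.braiding_naturality_left, ← Category.assoc, hg,
        zero_comp])
    refine ⟨m ≫ (β_ _ _).hom, ?_⟩
    rw [Category.assoc, ← BraidedCategory.braiding_naturality_right, ← Category.assoc, hm,
      Category.assoc, SymmetricCategory.symmetry, Category.comp_id]

theorem IsDaggerCokernelOf.whiskerRight {X Y Q : C} {c : Y ⟶ Q} {f : X ⟶ Y}
    (h : IsDaggerCokernelOf c f) (A : C) : IsDaggerCokernelOf (c ▷ A) (f ▷ A) := by
  simpa only [dag_whiskerRight, dag_dag] using (h.dag.whiskerRight A).dag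

theorem IsDaggerKernel.whiskerLeft (A : C) {K X : C} {k : K ⟶ X} (h : IsDaggerKernel k) :
    IsDaggerKernel (A ◁ k) := by
  obtain ⟨Y, f, hf⟩ := h
  exact ⟨_, _, hf.whiskerLeft A⟩

theorem IsDaggerKernel.whiskerRight {K X : C} {k : K ⟶ X} (h : IsDaggerKernel k) (A : C) :
    IsDaggerKernel (k ▷ A) := by
  obtain ⟨Y, f, hf⟩ := h
  exact ⟨_, _, hf.whiskerRight A⟩

theorem IsDaggerCokernel.whiskerLeft (A : C) {X Q : C} {c : X ⟶ Q} (h : IsDaggerCokernel c) :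
    IsDaggerCokernel (A ◁ c) := by
  rw [isDaggerCokernel_iff] at h ⊢
  rw [dag_whiskerLeft]
  exact h.whiskerLeft A

end DaggerMonoidal

/-! ### Kernel-pure states, atoms and the covering law -/

section Pure

variable {C : Type u} [Category.{v} C] [MonoidalCategory C] [DaggerCategory C]
  [HasZeroMorphisms C] [HasDaggerKernels C]

/-- Nonzero scalars are epimorphic with respect to zero. -/
theorem eq_zero_of_scalar_comp
    (hstate : ∀ A : C, ¬ IsZero A → ∃ ψ : 𝟙_ C ⟶ A, IsKernelState ψ)
    {s : 𝟙_ C ⟶ 𝟙_ C} (hs : s ≠ 0) {A : C} {f : 𝟙_ C ⟶ A} (h : s ≫ f = 0) : f = 0 := by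
  obtain ⟨e, he⟩ := (ker_spec f).exists_lift s h
  have hz : ¬ IsZero (kerObj f) := fun hz => hs (by
    rw [← he, hz.eq_of_src (ker f) 0, comp_zero])
  -- A kernel state of the nonzero kernel of `f` gives an isometric scalar that kills `f`. Scalars
  -- commute, so it is unitary and can be cancelled.
  obtain ⟨χ, hχ⟩ := hstate _ hz
  have hu := (hχ.comp (isDaggerKernel_ker f)).isIsometry.isUnitary_scalar
  rw [← Category.id_comp f, ← hu.2, Category.assoc, Category.assoc, (ker_spec f).comp_eq_zero,
    comp_zero, comp_zero]

theorem IsKernelPureState.exists_scalar {A : C} {ψ : 𝟙_ C ⟶ A} (h : IsKernelPureState ψ) :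
    ψ = 0 ∨ ∃ (s : 𝟙_ C ⟶ 𝟙_ C) (k : 𝟙_ C ⟶ A), IsKernelState k ∧ ψ = s ≫ k := by
  obtain h | h := h
  · exact Or.inl h
  · obtain ⟨U, hU⟩ : ∃ U : kerObj (coker ψ) ⟶ 𝟙_ C, IsUnitary U := h
    obtain ⟨e, he⟩ := (ker_spec (coker ψ)).exists_lift ψ (comp_coker ψ)
    refine Or.inr ⟨e ≫ U, dag U ≫ ker (coker ψ), (isDaggerKernel_ker _).unitary_comp hU.dag, ?_⟩
    rw [Category.assoc, ← Category.assoc U, hU.1, Category.id_comp, he]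

/-- For `s ≠ 0` the image of `s ≫ k` is `k` itself: by cancellation of `s`, `k` is killed by the
cokernel of `s ≫ k`. -/
theorem IsKernelState.isKernelPureState_comp
    (hstate : ∀ A : C, ¬ IsZero A → ∃ ψ : 𝟙_ C ⟶ A, IsKernelState ψ)
    {A : C} {k : 𝟙_ C ⟶ A} (hk : IsKernelState k) (s : 𝟙_ C ⟶ 𝟙_ C) :
    IsKernelPureState (s ≫ k) := by
  by_cases hs : s = 0
  · exact Or.inl (by rw [hs, zero_comp])
  · have e : DKer.imClass (s ≫ k) = DKer.mk k hk := by
      refine le_antisymm (DKer.imClass_le_iff.2 ⟨s, rfl⟩) (DKer.mk_le_iff.2 ?_)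
      rw [DKer.imClass, DKer.factors_kerClass]
      exact eq_zero_of_scalar_comp hstate hs (by rw [← Category.assoc, comp_coker])
    obtain ⟨U, hU, -⟩ := Quotient.exact e
    exact Or.inr ⟨U, hU⟩

theorem IsKernelPureState.scalar_comp
    (hstate : ∀ A : C, ¬ IsZero A → ∃ ψ : 𝟙_ C ⟶ A, IsKernelState ψ)
    {A : C} {ψ : 𝟙_ C ⟶ A} (h : IsKernelPureState ψ) (r : 𝟙_ C ⟶ 𝟙_ C) :
    IsKernelPureState (r ≫ ψ) := by
  obtain rfl | ⟨s, k, hk, rfl⟩ := h.exists_scalar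
  · exact Or.inl comp_zero
  · rw [← Category.assoc]
    exact hk.isKernelPureState_comp hstate _

theorem IsKernelPureState.comp_kernel
    (hstate : ∀ A : C, ¬ IsZero A → ∃ ψ : 𝟙_ C ⟶ A, IsKernelState ψ)
    {A B : C} {ψ : 𝟙_ C ⟶ A} (h : IsKernelPureState ψ) {l : A ⟶ B} (hl : IsDaggerKernel l) :
    IsKernelPureState (ψ ≫ l) := by
  obtain rfl | ⟨s, k, hk, rfl⟩ := h.exists_scalar
  · exact Or.inl zero_comp
  · rw [Category.assoc]
    exact IsKernelState.isKernelPureState_comp hstate (IsDaggerKernel.comp hk hl) s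

theorem IsKernelPureState.comp_unitary
    (hstate : ∀ A : C, ¬ IsZero A → ∃ ψ : 𝟙_ C ⟶ A, IsKernelState ψ)
    {A B : C} {ψ : 𝟙_ C ⟶ A} (h : IsKernelPureState ψ) {w : A ⟶ B} (hw : IsUnitary w) :
    IsKernelPureState (ψ ≫ w) := by
  obtain rfl | ⟨s, k, hk, rfl⟩ := h.exists_scalar
  · exact Or.inl zero_comp
  · rw [Category.assoc]
    exact IsKernelState.isKernelPureState_comp hstate (IsDaggerKernel.comp_unitary hk hw) s

namespace DKer

/-- Every nonzero kernel has a kernel state below it. An atom must equal that state; and below a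
kernel with domain `I`, the comparison is an isometric scalar up to a unitary, hence invertible. -/
theorem isAtom_mk_iff
    (hstate : ∀ A : C, ¬ IsZero A → ∃ ψ : 𝟙_ C ⟶ A, IsKernelState ψ)
    (hI : ¬ IsZero (𝟙_ C)) {A K : C} {k : K ⟶ A} (hk : IsDaggerKernel k) :
    IsAtom (mk k hk) ↔ ∃ U : K ⟶ 𝟙_ C, IsUnitary U := by
  constructor
  · intro h
    obtain ⟨χ, hχ⟩ := hstate K (fun hK => h.1 (mk_eq_bot_iff.2 hK))
    have hχk : IsDaggerKernel (χ ≫ k) := IsDaggerKernel.comp hχ hk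
    have hle : mk (χ ≫ k) hχk ≤ mk k hk := ⟨χ, rfl⟩
    obtain h' | h' := h.le_iff.1 hle
    · exact absurd (mk_eq_bot_iff.1 h') hI
    · obtain ⟨U, hU, -⟩ := Quotient.exact h'.symm
      exact ⟨U, hU⟩
  · rintro ⟨U, hU⟩
    refine isAtom_iff_le_of_ge.2 ⟨fun h => hI ?_, fun b hb hle => ?_⟩
    · rw [IsZero.iff_id_eq_zero, ← hU.2, (mk_eq_bot_iff.1 h).eq_of_src U 0, comp_zero]
    · obtain ⟨L, l, hl, rfl⟩ := exists_rep b
      obtain ⟨χ, hχ⟩ := hstate L (fun hL => hb (mk_eq_bot_iff.2 hL))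
      obtain ⟨m, hm⟩ := mk_le_mk.1 hle
      have hi : IsIsometry (χ ≫ m) := by
        refine IsIsometry.of_comp (g := k) ?_ hk.isIsometry
        rw [Category.assoc, hm]
        exact (IsDaggerKernel.comp hχ hl).isIsometry
      have hv : IsUnitary ((χ ≫ m) ≫ U) := (hi.comp hU.1).isUnitary_scalar
      have hm' : IsUnitary (χ ≫ m) := by
        have := hv.comp hU.dag
        rwa [Category.assoc, hU.1, Category.comp_id] at this
      rw [mk_le_mk]
      refine ⟨dag (χ ≫ m) ≫ χ, ?_⟩
      rw [Category.assoc, ← hm, ← Category.assoc χ, ← Category.assoc, hm'.2, Category.id_comp]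

end DKer

theorem isKernelPureState_iff_isAtom
    (hstate : ∀ A : C, ¬ IsZero A → ∃ ψ : 𝟙_ C ⟶ A, IsKernelState ψ)
    (hI : ¬ IsZero (𝟙_ C)) {A : C} {ψ : 𝟙_ C ⟶ A} :
    IsKernelPureState ψ ↔ ψ = 0 ∨ IsAtom (DKer.imClass ψ) := by
  rw [DKer.imClass, DKer.kerClass, DKer.isAtom_mk_iff hstate hI]
  rfl

theorem coveringLaw_iff [SymmetricCategory C] [DaggerSymmetricMonoidal C] [LeftRigidCategory C]
    (hstate : ∀ A : C, ¬ IsZero A → ∃ ψ : 𝟙_ C ⟶ A, IsKernelState ψ) :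
    (∀ (A Q : C) (ψ : 𝟙_ C ⟶ A) (c : A ⟶ Q), IsKernelState ψ →
      IsDaggerCokernel c → IsKernelPureState (ψ ≫ c)) ↔ ∀ A : C, CoveringLaw (DKer A) := by
  -- If the unit is zero, so is every object: there are no atoms, and all states vanish.
  by_cases hI : IsZero (𝟙_ C)
  · refine ⟨fun _ A a b ha => Or.inl ?_, fun _ A Q ψ c _ _ => Or.inl (hI.eq_of_src _ _)⟩
    obtain ⟨K, k, hk, rfl⟩ := DKer.exists_rep a
    exact absurd (DKer.mk_eq_bot_iff.2 (isZero_of_isZero_unit hI K)) ha.1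
  -- The two ways of being kernel-pure, zero image state and atomic image, are the two alternatives
  -- of the covering law.
  have key : ∀ {A Q : C} (ψ : 𝟙_ C ⟶ A) (c : A ⟶ Q) (hψ : IsDaggerKernel ψ),
      IsDaggerCokernel c → (IsKernelPureState (ψ ≫ c) ↔
        DKer.mk ψ hψ ≤ DKer.kerClass c ∨ DKer.kerClass c ⋖ DKer.mk ψ hψ ⊔ DKer.kerClass c) := by
    intro A Q ψ c hψ hc
    rw [isKernelPureState_iff_isAtom hstate hI, DKer.isAtom_imClass_iff hc, DKer.mk_le_iff,
      DKer.factors_kerClass, DKer.imClass_eq_mk hψ]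
  constructor
  · intro H A a b ha
    obtain ⟨K, k, hk, rfl⟩ := DKer.exists_rep a
    obtain ⟨U, hU⟩ := (DKer.isAtom_mk_iff hstate hI hk).1 ha
    obtain ⟨Q, c, hc, rfl⟩ := DKer.exists_eq_kerClass_cokernel b
    have hψ : IsDaggerKernel (dag U ≫ k) := hk.unitary_comp hU.dag
    have e : DKer.mk k hk = DKer.mk (dag U ≫ k) hψ :=
      Quotient.sound ⟨U, hU, by
        change U ≫ dag U ≫ k = k
        rw [← Category.assoc, hU.1, Category.id_comp]⟩
    rw [e]
    exact (key _ c hψ hc).1 (H _ _ _ _ hψ hc)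
  · intro H A Q ψ c hψ hc
    refine (key ψ c hψ hc).2 (H A _ _ ((DKer.isAtom_mk_iff hstate hI hψ).2 ⟨𝟙 _, ?_⟩))
    rw [IsUnitary, dag_id, Category.comp_id]
    exact ⟨rfl, rfl⟩

end Pure

end DaggerCategory

namespace DaggerCategory

/-! ### Cups, caps, states and transposes -/

section Duals

variable {C : Type u} [Category.{v} C] [MonoidalCategory C] [LeftRigidCategory C]

/-- The chosen dual of `A`. -/
abbrev dualObj (A : C) : C := HasLeftDual.leftDual A

/-- The cup of `A`. -/
def cup (A : C) : 𝟙_ C ⟶ dualObj A ⊗ A := ExactPairing.coevaluation (dualObj A) A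

/-- The cap of `A`. -/
def cap (A : C) : A ⊗ dualObj A ⟶ 𝟙_ C := ExactPairing.evaluation (dualObj A) A

theorem whiskerLeft_cup_cap (A : C) :
    A ◁ cup A ≫ (α_ _ _ _).inv ≫ cap A ▷ A = (ρ_ A).hom ≫ (λ_ A).inv :=
  ExactPairing.coevaluation_evaluation _ _

theorem whiskerRight_cup_cap (A : C) :
    cup A ▷ dualObj A ≫ (α_ _ _ _).hom ≫ dualObj A ◁ cap A =
      (λ_ (dualObj A)).hom ≫ (ρ_ (dualObj A)).inv :=
  ExactPairing.evaluation_coevaluation _ _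

theorem stateOf_eq {A B : C} (f : A ⟶ B) : stateOf f = cup A ≫ dualObj A ◁ f := rfl

theorem stateOf_comp {A B D : C} (f : A ⟶ B) (g : B ⟶ D) :
    stateOf (f ≫ g) = stateOf f ≫ dualObj A ◁ g := by
  rw [stateOf_eq, stateOf_eq, MonoidalCategory.whiskerLeft_comp, Category.assoc]

theorem stateOf_id (A : C) : stateOf (𝟙 A) = cup A := by
  rw [stateOf_eq, MonoidalCategory.whiskerLeft_id, Category.comp_id]

/-- A morphism is recovered from its state by the cap. -/
theorem eq_of_stateOf {A B : C} (f : A ⟶ B) :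
    f = (ρ_ A).inv ≫ A ◁ stateOf f ≫ (α_ _ _ _).inv ≫ cap A ▷ B ≫ (λ_ B).hom :=
  (Iso.eq_inv_comp (ρ_ A)).2
    (tensorLeftHomEquiv_symm_coevaluation_comp_whiskerLeft (Y := dualObj A) f).symm

theorem cup_comp_whiskerRight_injective {X Z : C} {h h' : dualObj X ⟶ Z}
    (e : cup X ≫ h ▷ X = cup X ≫ h' ▷ X) : h = h' := by
  have e' := congrArg (tensorRightHomEquiv (𝟙_ C) (dualObj X) X Z).symm e
  rw [cup, tensorRightHomEquiv_symm_coevaluation_comp_whiskerRight,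
    tensorRightHomEquiv_symm_coevaluation_comp_whiskerRight] at e'
  exact (cancel_epi _).1 e'

theorem whiskerLeft_comp_cap_injective {W A : C} {h h' : W ⟶ dualObj A}
    (e : A ◁ h ≫ cap A = A ◁ h' ≫ cap A) : h = h' := by
  have e' := congrArg (tensorLeftHomEquiv W (dualObj A) A (𝟙_ C)) e
  rw [cap, tensorLeftHomEquiv_whiskerLeft_comp_evaluation,
    tensorLeftHomEquiv_whiskerLeft_comp_evaluation] at e'
  exact (cancel_mono _).1 e'

/-- The transpose of a morphism. -/
def transpose {X Y : C} (f : X ⟶ Y) : dualObj Y ⟶ dualObj X := leftAdjointMate f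

theorem cup_comp_transpose {X Y : C} (f : X ⟶ Y) :
    cup Y ≫ transpose f ▷ Y = cup X ≫ dualObj X ◁ f :=
  coevaluation_comp_leftAdjointMate f

theorem transpose_comp_cap {X Y : C} (f : X ⟶ Y) :
    X ◁ transpose f ≫ cap X = f ▷ dualObj Y ≫ cap Y :=
  leftAdjointMate_comp_evaluation f

theorem transpose_comp {X Y Z : C} (f : X ⟶ Y) (g : Y ⟶ Z) :
    transpose (f ≫ g) = transpose g ≫ transpose f :=
  comp_leftAdjointMate

theorem transpose_id (X : C) : transpose (𝟙 X) = 𝟙 (dualObj X) := leftAdjointMate_id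

theorem transpose_zero [SymmetricCategory C] [HasZeroMorphisms C] (X Y : C) : transpose (0 : X ⟶ Y) = 0 := by
  apply cup_comp_whiskerRight_injective
  rw [cup_comp_transpose, whiskerLeft_zero', zero_whiskerRight', comp_zero, comp_zero]

/-- The comparison of the unit with its dual. -/
def unitToDual : 𝟙_ C ⟶ dualObj (𝟙_ C) := cup (𝟙_ C) ≫ (ρ_ _).hom

/-- The inverse of `unitToDual`. -/
def dualToUnit : dualObj (𝟙_ C) ⟶ 𝟙_ C := (λ_ _).inv ≫ cap (𝟙_ C)

/-- This is a snake equation at the unit object, with the unitors stripped off. -/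
theorem unitToDual_dualToUnit : unitToDual ≫ dualToUnit = 𝟙 (𝟙_ C) := by
  have h := whiskerLeft_cup_cap (𝟙_ C)
  have h1 : cup (𝟙_ C) = unitToDual ≫ (ρ_ _).inv := by simp [unitToDual]
  have h2 : cap (𝟙_ C) = (λ_ _).hom ≫ dualToUnit := by simp [dualToUnit]
  rw [h1, h2] at h
  calc unitToDual ≫ dualToUnit
      = (λ_ _).inv ≫ (𝟙_ C ◁ (unitToDual ≫ (ρ_ _).inv) ≫ (α_ _ _ _).inv ≫
          ((λ_ _).hom ≫ dualToUnit) ▷ 𝟙_ C) ≫ (ρ_ _).hom := by monoidal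
    _ = 𝟙 (𝟙_ C) := by rw [h]; monoidal

theorem dualToUnit_unitToDual : dualToUnit ≫ unitToDual = 𝟙 (dualObj (𝟙_ C)) := by
  have h := whiskerRight_cup_cap (𝟙_ C)
  have h1 : cup (𝟙_ C) = unitToDual ≫ (ρ_ _).inv := by simp [unitToDual]
  have h2 : cap (𝟙_ C) = (λ_ _).hom ≫ dualToUnit := by simp [dualToUnit]
  rw [h1, h2] at h
  calc dualToUnit ≫ unitToDual
      = (λ_ _).inv ≫ (𝟙_ C ◁ dualToUnit ≫ unitToDual ▷ 𝟙_ C) ≫ (ρ_ _).hom := by monoidal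
    _ = (λ_ _).inv ≫ (unitToDual ▷ dualObj (𝟙_ C) ≫ dualObj (𝟙_ C) ◁ dualToUnit) ≫
          (ρ_ _).hom := by rw [whisker_exchange]
    _ = (λ_ _).inv ≫ ((unitToDual ≫ (ρ_ _).inv) ▷ dualObj (𝟙_ C) ≫ (α_ _ _ _).hom ≫
          dualObj (𝟙_ C) ◁ ((λ_ _).hom ≫ dualToUnit)) ≫ (ρ_ _).hom := by monoidal
    _ = 𝟙 _ := by rw [h]; monoidal

/-- Since `unitToDual` is unitary in the dagger compact case, this makes kernel-purity of `ψ` as a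
morphism and as a state agree. -/
theorem stateOf_state {A : C} (ψ : 𝟙_ C ⟶ A) :
    stateOf ψ = ψ ≫ (λ_ A).inv ≫ unitToDual ▷ A := by
  have h1 : cup (𝟙_ C) = unitToDual ≫ (ρ_ _).inv := by simp [unitToDual]
  rw [stateOf_eq, h1]
  calc (unitToDual ≫ (ρ_ _).inv) ≫ dualObj (𝟙_ C) ◁ ψ
      = (λ_ _).inv ≫ (unitToDual ▷ 𝟙_ C ≫ dualObj (𝟙_ C) ◁ ψ) := by monoidal
    _ = (λ_ _).inv ≫ (𝟙_ C ◁ ψ ≫ unitToDual ▷ A) := by rw [whisker_exchange]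
    _ = ψ ≫ (λ_ A).inv ≫ unitToDual ▷ A := by monoidal

end Duals

/-! ### Transposes of cokernels and factorization of kernel-pure morphisms -/

section DaggerCompact

variable {C : Type u} [Category.{v} C] [MonoidalCategory C] [SymmetricCategory C]
  [DaggerCategory C] [LeftRigidCategory C] [DaggerCompactCategory C]

theorem cap_eq (A : C) : cap A = (β_ A (dualObj A)).hom ≫ dag (cup A) :=
  DaggerCompactCategory.dagger_dual A

theorem dag_cap (A : C) : dag (cap A) = cup A ≫ (β_ (dualObj A) A).hom := by
  rw [cap_eq, dag_comp, dag_dag,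
    (DaggerSymmetricMonoidal.unitary_braiding A (dualObj A)).dag_eq_inv,
    ← SymmetricCategory.braiding_swap_eq_inv_braiding]

theorem isUnitary_unitToDual : IsUnitary (unitToDual : 𝟙_ C ⟶ _) := by
  refine IsUnitary.of_inverse unitToDual_dualToUnit dualToUnit_unitToDual ?_
  rw [unitToDual, dualToUnit, dag_comp,
    (DaggerSymmetricMonoidal.unitary_rightUnitor _).dag_eq_inv, cap_eq,
    leftUnitor_inv_braiding_assoc]

/-- The dagger of the equation sliding `f` along a cap is, once the braiding is cancelled, the
equation sliding `dag f` along a cup. -/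
theorem dag_transpose {X Y : C} (f : X ⟶ Y) : dag (transpose f) = transpose (dag f) := by
  apply cup_comp_whiskerRight_injective
  have h := congrArg dag (transpose_comp_cap f)
  rw [dag_comp, dag_comp, dag_whiskerLeft, dag_whiskerRight, dag_cap, dag_cap, Category.assoc,
    Category.assoc, ← BraidedCategory.braiding_naturality_left,
    ← BraidedCategory.braiding_naturality_right, ← Category.assoc, ← Category.assoc,
    cancel_mono] at h
  rw [h, cup_comp_transpose]

variable [HasZeroMorphisms C]

theorem IsDaggerCokernel.transpose {A Q : C} {c : A ⟶ Q} (hc : IsDaggerCokernel c) :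
    IsDaggerKernel (transpose c) := by
  have hi : DaggerCategory.dag c ≫ c = 𝟙 Q := by simpa only [IsIsometry, dag_dag] using hc.dag.isIsometry
  obtain ⟨M, m, hm⟩ := hc
  refine ⟨_, DaggerCategory.transpose m, isDaggerKernelOf_of_lift ?_ ?_ fun {W} h hh => ?_⟩
  · rw [IsIsometry, dag_transpose, ← transpose_comp, hi, transpose_id]
  · rw [← transpose_comp, hm.2.1, transpose_zero]
  · refine ⟨h ≫ DaggerCategory.transpose (DaggerCategory.dag c), ?_⟩
    -- Bent by the cap, `h` becomes a morphism on `A ⊗ W` that kills `m ▷ W`, so it descends along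
    -- the cokernel `c ▷ W`.
    obtain ⟨p, hp⟩ := (hm.whiskerRight W).exists_desc (A ◁ h ≫ cap A) (by
      rw [← whisker_exchange_assoc, ← transpose_comp_cap, ← Category.assoc,
        ← MonoidalCategory.whiskerLeft_comp, hh, whiskerLeft_zero', zero_comp])
    rw [Category.assoc, ← transpose_comp]
    apply whiskerLeft_comp_cap_injective
    rw [MonoidalCategory.whiskerLeft_comp, Category.assoc, transpose_comp_cap,
      whisker_exchange_assoc, ← hp, ← Category.assoc, ← comp_whiskerRight, Category.assoc, hi,
      Category.comp_id]

variable [HasDaggerKernels C]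

theorem isKernelPure_state_iff
    (hstate : ∀ A : C, ¬ IsZero A → ∃ ψ : 𝟙_ C ⟶ A, IsKernelState ψ)
    {A : C} (ψ : 𝟙_ C ⟶ A) : IsKernelPure ψ ↔ IsKernelPureState ψ := by
  have hw : IsUnitary ((λ_ A).inv ≫ (unitToDual : 𝟙_ C ⟶ _) ▷ A) :=
    (DaggerSymmetricMonoidal.unitary_leftUnitor A).inv.comp (isUnitary_unitToDual.whiskerRight A)
  rw [IsKernelPure, stateOf_state]
  refine ⟨fun h => ?_, fun h => h.comp_unitary hstate hw⟩
  have h' := h.comp_unitary hstate hw.dag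
  rwa [Category.assoc, hw.1, Category.comp_id] at h'

/-- Slid around the cup, `c` becomes the dagger kernel `transpose c ▷ Q` applied to the kernel-pure
cup of `Q`. -/
theorem IsDaggerCokernel.isKernelPure
    (hstate : ∀ A : C, ¬ IsZero A → ∃ ψ : 𝟙_ C ⟶ A, IsKernelState ψ)
    (hid : ∀ A : C, IsKernelPure (𝟙 A)) {A Q : C} {c : A ⟶ Q} (hc : IsDaggerCokernel c) :
    IsKernelPure c := by
  have h := hid Q
  rw [IsKernelPure, stateOf_id] at h
  rw [IsKernelPure, stateOf_eq, ← cup_comp_transpose]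
  exact h.comp_kernel hstate (hc.transpose.whiskerRight Q)

/-- A nonzero kernel-pure morphism is, up to a scalar, a dagger kernel followed by a dagger
cokernel. -/
theorem IsKernelPure.exists_factorization (hid : ∀ A : C, IsKernelPure (𝟙 A))
    {B D : C} {g : B ⟶ D} (hg : IsKernelPure g) :
    g = 0 ∨ ∃ (E : C) (κ : B ⟶ E) (c : E ⟶ D) (r : 𝟙_ C ⟶ 𝟙_ C),
      IsDaggerKernel κ ∧ IsDaggerCokernel c ∧ g = κ ≫ c ≫ scal r D := by
  have hB := hid B
  rw [IsKernelPure, stateOf_id] at hB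
  have hzero : stateOf g = 0 → g = 0 := fun h => by
    rw [eq_of_stateOf g, h, whiskerLeft_zero', zero_comp, comp_zero]
  obtain h | ⟨t, l, hl, ht⟩ := IsKernelPureState.exists_scalar hg
  · exact Or.inl (hzero h)
  obtain h | ⟨s, k, hk, hs⟩ := hB.exists_scalar
  · exact Or.inl (hzero (by rw [stateOf_eq, h, zero_comp]))
  -- The witnesses are read off the yanking formula `eq_of_stateOf`: the state of `g` is `t ≫ l`,
  -- which supplies the kernel, and the cap of `B` is the braiding followed by the dagger of the cup
  -- `s ≫ k`, which supplies the cokernel.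
  refine Or.inr ⟨_, (ρ_ B).inv ≫ B ◁ l ≫ (α_ _ _ _).inv,
    (β_ B (dualObj B)).hom ▷ D ≫ dag k ▷ D ≫ (λ_ D).hom, t ≫ dag s, ?_, ?_, ?_⟩
  · exact ((IsDaggerKernel.whiskerLeft B hl).comp_unitary
      (DaggerSymmetricMonoidal.unitary_associator _ _ _).inv).unitary_comp
      (DaggerSymmetricMonoidal.unitary_rightUnitor B).inv
  · rw [isDaggerCokernel_iff, dag_comp, dag_comp, Category.assoc, dag_whiskerRight, dag_dag]
    exact ((IsDaggerKernel.whiskerRight hk D).comp_unitary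
      ((DaggerSymmetricMonoidal.unitary_braiding _ _).whiskerRight D).dag).unitary_comp
      (DaggerSymmetricMonoidal.unitary_leftUnitor D).dag
  -- It remains to move both scalars to the codomain `D`, which naturality of `scal` allows.
  · have h1 : B ◁ t = scal t (B ⊗ 𝟙_ C) := by rw [← whiskerLeft_scal, scal_unit]
    have h2 : dag s ▷ D ≫ (λ_ D).hom = (λ_ D).hom ≫ scal (dag s) D := by simp [scal]
    have h3 : scal (t ≫ dag s) D = scal (dag s) D ≫ scal t D := by
      rw [comp_scal]; simp [scal]
    conv_lhs => rw [eq_of_stateOf g, ht, cap_eq, hs]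
    rw [MonoidalCategory.whiskerLeft_comp, h1, dag_comp, comp_whiskerRight, comp_whiskerRight, h3]
    simp only [Category.assoc]
    rw [h2]
    rw [← comp_scal t]
    simp only [Category.assoc]

end DaggerCompact

end DaggerCategory

theorem mainTheorem12 {C : Type u} [Category.{v} C] [MonoidalCategory C] [SymmetricCategory C]
    [DaggerCategory C] [LeftRigidCategory C] [DaggerCategory.DaggerCompactCategory C]
    [HasZeroMorphisms C] [DaggerCategory.HasDaggerKernels C]
    (hstate : ∀ A : C, ¬ IsZero A → ∃ ψ : 𝟙_ C ⟶ A, DaggerCategory.IsKernelState ψ)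
    (hid : ∀ A : C, DaggerCategory.IsKernelPure (𝟙 A)) :
    List.TFAE [
      ∀ (A Q : C) (ψ : 𝟙_ C ⟶ A) (c : A ⟶ Q), DaggerCategory.IsKernelState ψ →
        DaggerCategory.IsDaggerCokernel c → DaggerCategory.IsKernelPureState (ψ ≫ c),
      ∀ (A Q : C) (ψ : 𝟙_ C ⟶ A) (c : A ⟶ Q), DaggerCategory.IsKernelPureState ψ →
        DaggerCategory.IsDaggerCokernel c → DaggerCategory.IsKernelPureState (ψ ≫ c),
      ∀ (A B D : C) (f : A ⟶ B) (g : B ⟶ D), DaggerCategory.IsKernelPure f →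
        DaggerCategory.IsKernelPure g → DaggerCategory.IsKernelPure (f ≫ g),
      ∀ A : C, DaggerCategory.CoveringLaw (DaggerCategory.DKer A)] := by
  open DaggerCategory in
  tfae_have 1 ↔ 4 := coveringLaw_iff hstate
  tfae_have 1 → 2 := by
    intro H A Q ψ c hψ hc
    obtain rfl | ⟨s, k, hk, rfl⟩ := hψ.exists_scalar
    · exact Or.inl zero_comp
    · rw [Category.assoc]
      exact (H A Q k c hk hc).scalar_comp hstate s
  tfae_have 2 → 3 := by
    intro H A B D f g hf hg
    rw [IsKernelPure, stateOf_comp]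
    obtain rfl | ⟨E, κ, c, r, hκ, hc, rfl⟩ := hg.exists_factorization hid
    · exact Or.inl (by rw [whiskerLeft_zero', comp_zero])
    · have h := H _ _ _ _ (IsKernelPureState.comp_kernel hstate hf (hκ.whiskerLeft (dualObj A)))
        (hc.whiskerLeft (dualObj A))
      rw [MonoidalCategory.whiskerLeft_comp, MonoidalCategory.whiskerLeft_comp, whiskerLeft_scal,
        ← Category.assoc, ← Category.assoc, state_comp_scal]
      exact h.scalar_comp hstate r
  tfae_have 3 → 1 := by
    intro H A Q ψ c hψ hc
    -- A kernel state is its own multiple by the identity scalar.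
    have h : IsKernelPureState ψ := by
      simpa only [Category.id_comp] using hψ.isKernelPureState_comp hstate (𝟙 _)
    exact (isKernelPure_state_iff hstate _).1
      (H _ _ _ ψ c ((isKernelPure_state_iff hstate _).2 h) (hc.isKernelPure hstate hid))
  tfae_finish
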